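/- Formulas are built from a denumerable set of variables with the connectives $\&,\wedge,\to$ (binary) and $\bot$ (0-ary), and $\varphi\vee\psi$ abbreviates $((\varphi\to\psi)\to\psi)\wedge((\psi\to\varphi)\to\varphi)$. The monoidal t-norm based logic MTL has modus ponens as its only rule and the axiom schemata $(\varphi\to\psi)\to((\psi\to\chi)\to(\varphi\to\chi))$; $(\varphi\&\psi)\to\varphi$; $(\varphi\&\psi)\to(\psi\&\varphi)$; $(\varphi\wedge\psi)\to\varphi$; $(\varphi\wedge\psi)\to(\psi\wedge\varphi)$; $(\varphi\&(\varphi\to\psi))\to(\psi\wedge\varphi)$; $(\varphi\to(\psi\to\chi))\to((\varphi\&\psi)\to\chi)$; $((\varphi\&\psi)\to\chi)\to(\varphi\to(\psi\to\chi))$; $((\varphi\to\psi)\to\chi)\to(((\psi\to\varphi)\to\chi)\to\chi)$; $\bot\to\varphi$. An axiomatic extension of MTL is a logic obtained by adding a set of further axiom schemata; it is identified with its set of theorems. The axiomatic extensions of MTL, ordered by inclusion, form a lattice in which the meet is intersection. An MTL-algebra is an algebra $\langle A,*,\Rightarrow,\sqcap,\sqcup,0,1\rangle$ such that $\langle A,\sqcap,\sqcup,0,1\rangle$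 is a lattice with minimum $0$ and maximum $1$, $\langle A,*,1\rangle$ is a commutative monoid, $z*x\le y$ iff $z\le x\Rightarrow y$ for all $x,y,z\in A$, and $(x\Rightarrow y)\sqcup(y\Rightarrow x)=1$ for all $x,y\in A$. An MTL-chain is a totally ordered MTL-algebra (the one-element algebra is allowed). A formula is valid in $A$ if every assignment of elements of $A$ to the variables gives it the value $1$, where $\&,\wedge,\to,\bot$ are interpreted by $*,\sqcap,\Rightarrow,0$. **Theorem.** Let $L$ be an axiomatic extension of MTL. The following are equivalent. 1. $L$ has the Halldén completeness: for all formulas $\varphi,\psi$ with no variables in common, if $\vdash_L\varphi\vee\psi$ then $\vdash_L\varphi$ or $\vdash_L\psi$. 2. There is an MTL-chain $A$ such that $L$ is complete with respect to $A$, that is, for every formula $\varphi$, $\vdash_L\varphi$ if and only if $\varphi$ is valid in $A$. 3. $L$ is meet irreducible in the lattice of axiomatic extensions of MTL: for all axiomatic extensions $L_1,L_2$ of MTL, if $L=L_1\cap L_2$ then $L=L_1$ or $L=L_2$. -/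

import Mathlib

namespace MTL

/-- Formulas over the primitive connectives `&`, `∧`, `→`, `⊥` and the denumerable set of
variables indexed by `ℕ`. -/
inductive Formula : Type
  | var (n : ℕ) : Formula
  | bot : Formula
  | conj (φ ψ : Formula) : Formula
  | meet (φ ψ : Formula) : Formula
  | imp (φ ψ : Formula) : Formula

namespace Formula

/-- Derived disjunction `((φ → ψ) → ψ) ∧ ((ψ → φ) → φ)`. -/
def disj (φ ψ : Formula) : Formula :=
  meet (imp (imp φ ψ) ψ) (imp (imp ψ φ) φ)

/-- The set of variables occurring in a formula. -/
def vars : Formula → Finset ℕ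
  | var n => {n}
  | bot => ∅
  | conj φ ψ => φ.vars ∪ ψ.vars
  | meet φ ψ => φ.vars ∪ ψ.vars
  | imp φ ψ => φ.vars ∪ ψ.vars

/-- Uniform substitution of formulas for variables. -/
def subst (s : ℕ → Formula) : Formula → Formula
  | var n => s n
  | bot => bot
  | conj φ ψ => conj (φ.subst s) (ψ.subst s)
  | meet φ ψ => meet (φ.subst s) (ψ.subst s)
  | imp φ ψ => imp (φ.subst s) (ψ.subst s)

theorem subst_var (φ : Formula) : φ.subst var = φ := by
  induction φ <;> simp_all [subst]

theorem subst_subst (s t : ℕ → Formula) (φ : Formula) :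
    (φ.subst s).subst t = φ.subst (fun n => (s n).subst t) := by
  induction φ <;> simp_all [subst]

end Formula

open Formula

/-- The axioms (A1)-(A9) of the logic MTL. -/
inductive IsAxiom : Formula → Prop
  | a1 (φ ψ χ : Formula) : IsAxiom (imp (imp φ ψ) (imp (imp ψ χ) (imp φ χ)))
  | a2 (φ ψ : Formula) : IsAxiom (imp (conj φ ψ) φ)
  | a3 (φ ψ : Formula) : IsAxiom (imp (conj φ ψ) (conj ψ φ))
  | a4 (φ ψ : Formula) : IsAxiom (imp (meet φ ψ) φ)
  | a5 (φ ψ : Formula) : IsAxiom (imp (meet φ ψ) (meet ψ φ))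
  | a6 (φ ψ : Formula) : IsAxiom (imp (conj φ (imp φ ψ)) (meet ψ φ))
  | a7a (φ ψ χ : Formula) : IsAxiom (imp (imp φ (imp ψ χ)) (imp (conj φ ψ) χ))
  | a7b (φ ψ χ : Formula) : IsAxiom (imp (imp (conj φ ψ) χ) (imp φ (imp ψ χ)))
  | a8 (φ ψ χ : Formula) :
      IsAxiom (imp (imp (imp φ ψ) χ) (imp (imp (imp ψ φ) χ) χ))
  | a9 (φ : Formula) : IsAxiom (imp bot φ)

theorem IsAxiom.subst {φ : Formula} (h : IsAxiom φ) (s : ℕ → Formula) :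
    IsAxiom (φ.subst s) := by
  cases h <;> simp only [Formula.subst] <;> constructor

/-- `Derivable S φ`: the formula `φ` has a proof by modus ponens from the axioms of MTL together
with the formulas in `S`, taken as additional axiom schemata. -/
inductive Derivable (S : Set Formula) : Formula → Prop
  | mtl {φ : Formula} (h : IsAxiom φ) : Derivable S φ
  | extra {φ : Formula} (h : φ ∈ S) (s : ℕ → Formula) : Derivable S (φ.subst s)
  | mp {φ ψ : Formula} (h₁ : Derivable S φ) (h₂ : Derivable S (imp φ ψ)) : Derivable S ψ

namespace Derivable

theorem of_mem {S : Set Formula} {φ : Formula} (h : φ ∈ S) : Derivable S φ := by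
  simpa [subst_var] using Derivable.extra h Formula.var

theorem subst {S : Set Formula} {φ : Formula} (h : Derivable S φ) (s : ℕ → Formula) :
    Derivable S (φ.subst s) := by
  induction h with
  | mtl h => exact .mtl (h.subst s)
  | extra h t => rw [subst_subst]; exact .extra h _
  | mp _ _ ih₁ ih₂ => exact .mp ih₁ ih₂

/-- A formula derivable from theorems of `T` is a theorem of `T`. -/
theorem trans {S T : Set Formula} (hST : ∀ φ ∈ S, Derivable T φ) {φ : Formula}
    (h : Derivable S φ) : Derivable T φ := by
  induction h with
  | mtl h => exact .mtl h
  | extra h t => exact (hST _ h).subst t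
  | mp _ _ ih₁ ih₂ => exact .mp ih₁ ih₂

end Derivable

/-- An axiomatic extension of MTL, identified with its set of theorems: the set of all formulas
derivable in MTL with some set of additional axiom schemata. -/
@[ext]
structure AxiomaticExtension where
  theorems : Set Formula
  axiomatizable : ∃ S : Set Formula, theorems = {φ | Derivable S φ}

namespace AxiomaticExtension

/-- `L.Proves φ` is `⊢_L φ`. -/
def Proves (L : AxiomaticExtension) (φ : Formula) : Prop := φ ∈ L.theorems

/-- The extension of MTL by the axiom schemata in `S`. -/
def ofAxioms (S : Set Formula) : AxiomaticExtension := ⟨{φ | Derivable S φ}, S, rfl⟩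

theorem mem_of_derivable (L : AxiomaticExtension) {φ : Formula}
    (h : Derivable L.theorems φ) : φ ∈ L.theorems := by
  obtain ⟨T, S, rfl⟩ := L
  exact h.trans fun _ h => h

/-- Axiomatic extensions are ordered by inclusion of their sets of theorems. -/
instance : PartialOrder AxiomaticExtension :=
  PartialOrder.lift theorems fun _ _ h => AxiomaticExtension.ext h

/-- The lattice of axiomatic extensions of MTL: the meet of two logics is the intersection of their
sets of theorems, their join is axiomatized by the union. -/
instance : Lattice AxiomaticExtension where
  inf L M :=
    { theorems := L.theorems ∩ M.theorems
      axiomatizable := ⟨L.theorems ∩ M.theorems, Set.Subset.antisymm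
        (fun _ h => Derivable.of_mem h)
        (fun _ h => ⟨L.mem_of_derivable (h.trans fun _ h => .of_mem h.1),
          M.mem_of_derivable (h.trans fun _ h => .of_mem h.2)⟩)⟩ }
  sup L M := ofAxioms (L.theorems ∪ M.theorems)
  inf_le_left _ _ := fun _ h => h.1
  inf_le_right _ _ := fun _ h => h.2
  le_inf _ _ _ h₁ h₂ := fun _ h => ⟨h₁ h, h₂ h⟩
  le_sup_left _ _ := fun _ h => Derivable.of_mem (Or.inl h)
  le_sup_right _ _ := fun _ h => Derivable.of_mem (Or.inr h)
  sup_le _ _ N h₁ h₂ := fun _ h => N.mem_of_derivable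
    (Derivable.trans (fun _ h => .of_mem (h.elim (fun h => h₁ h) (fun h => h₂ h))) h)

/-- Halldén completeness. -/
def HalldenComplete (L : AxiomaticExtension) : Prop :=
  ∀ φ ψ : Formula, Disjoint φ.vars ψ.vars → L.Proves (disj φ ψ) → L.Proves φ ∨ L.Proves ψ

end AxiomaticExtension

/-- An element of a lattice is meet irreducible if it is not the meet of two elements that are both
different from it. As opposed to `InfIrred`, a greatest element counts as meet irreducible. -/
def MeetIrreducible {α : Type*} [Lattice α] (a : α) : Prop :=
  ∀ b c : α, a = b ⊓ c → a = b ∨ a = c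

/-- FLew-algebras: bounded, integral, commutative residuated lattices. The monoid operation is `*`,
the least and greatest elements are `⊥` and `⊤ = 1`. -/
class FLewAlgebra (A : Type*) extends Lattice A, BoundedOrder A, CommMonoid A where
  /-- The residuum `x ⇒ y`. -/
  res : A → A → A
  one_eq_top : (1 : A) = ⊤
  mul_le_iff_le_res : ∀ x y z : A, z * x ≤ y ↔ z ≤ res x y

/-- MTL-algebras: prelinear FLew-algebras. -/
class MTLAlgebra (A : Type*) extends FLewAlgebra A where
  prelinearity : ∀ x y : A, res x y ⊔ res y x = 1

/-- An MTL-chain is a totally ordered MTL-algebra. -/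
def IsChain (A : Type*) [MTLAlgebra A] : Prop := ∀ x y : A, x ≤ y ∨ y ≤ x

/-- The value of a formula in an algebra under an assignment of the variables. -/
def Formula.eval {A : Type*} [MTLAlgebra A] (v : ℕ → A) : Formula → A
  | var n => v n
  | bot => ⊥
  | conj φ ψ => φ.eval v * ψ.eval v
  | meet φ ψ => φ.eval v ⊓ ψ.eval v
  | imp φ ψ => FLewAlgebra.res (φ.eval v) (ψ.eval v)

/-- `φ` is valid in `A` if every assignment gives it the value `1`. -/
def Valid (A : Type*) [MTLAlgebra A] (φ : Formula) : Prop := ∀ v : ℕ → A, φ.eval v = 1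

/-- `L` is complete with respect to `A`: the theorems of `L` are exactly the formulas valid
in `A`. -/
def CompleteWrt (L : AxiomaticExtension) (A : Type*) [MTLAlgebra A] : Prop :=
  ∀ φ : Formula, L.Proves φ ↔ Valid A φ

end MTL

/-!
The key notion is the coannihilator of a formula `θ` modulo a theory `T`, the theory of all `χ` with
`χ ∨ θ ∈ T`. It replaces the local deduction theorem: a set of axioms lies in the coannihilator of
`θ` as soon as each of them does, so whatever follows from `φ` and also from `ψ` follows from `T`
when all instances of `φ ∨ ψ` belong to `T`. This gives (3) → (1), since when `φ` and `ψ` have no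
common variables and `L` proves `φ ∨ ψ`, it proves every `φ' ∨ ψ'` with independently chosen
instances, so that `L` is the meet of its extensions by `φ` and by `ψ`. Conversely, two theorems
separating `L₁ ⊓ L₂` from `L₁` and from `L₂` can be renamed apart, and their disjunction violates
Halldén completeness.

For (1) → (2), rename all nontheorems of `L` apart. By Halldén completeness no finite disjunction of
these copies is a theorem, so a theory that is maximal among the extensions of `L` omitting all of
these disjunctions exists. It is prime, again by coannihilators, so its Lindenbaum algebra is a
chain, and each nontheorem is refuted there at its own variables.
-/

namespace MTL

open Formula

universe u

/-- A theory is a set of formulas that contains the axioms of MTL and is closed under modus ponens.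
As opposed to an axiomatic extension, it need not be closed under substitution. -/
structure Theory where
  carrier : Set Formula
  ax' : ∀ {φ : Formula}, IsAxiom φ → φ ∈ carrier
  mp' : ∀ {φ ψ : Formula}, φ ∈ carrier → imp φ ψ ∈ carrier → ψ ∈ carrier

namespace Theory

instance : SetLike Theory Formula where
  coe := carrier
  coe_injective := by rintro ⟨_⟩ ⟨_⟩ rfl; rfl

instance : PartialOrder Theory := .ofSetLike Theory Formula

variable {T : Theory} {φ ψ χ θ : Formula}

theorem ax (h : IsAxiom φ) : φ ∈ T := T.ax' h

theorem mp (h₁ : φ ∈ T) (h₂ : imp φ ψ ∈ T) : ψ ∈ T := T.mp' h₁ h₂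

theorem imp_trans (h₁ : imp φ ψ ∈ T) (h₂ : imp ψ χ ∈ T) : imp φ χ ∈ T :=
  mp h₂ (mp h₁ (ax (.a1 _ _ _)))

theorem curry (h : imp (conj φ ψ) χ ∈ T) : imp φ (imp ψ χ) ∈ T :=
  mp h (ax (.a7b _ _ _))

theorem uncurry (h : imp φ (imp ψ χ) ∈ T) : imp (conj φ ψ) χ ∈ T :=
  mp h (ax (.a7a _ _ _))

theorem conj_imp_left (φ ψ : Formula) : imp (conj φ ψ) φ ∈ T :=
  ax (.a2 _ _)

theorem conj_comm_imp (φ ψ : Formula) : imp (conj φ ψ) (conj ψ φ) ∈ T :=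
  ax (.a3 _ _)

theorem conj_imp_right (φ ψ : Formula) : imp (conj φ ψ) ψ ∈ T :=
  imp_trans (conj_comm_imp _ _) (conj_imp_left _ _)

theorem imp_imp_self (φ ψ : Formula) : imp φ (imp ψ φ) ∈ T :=
  curry (conj_imp_left _ _)

theorem imp_of_mem (h : φ ∈ T) (ψ : Formula) : imp ψ φ ∈ T :=
  mp h (imp_imp_self _ _)

theorem imp_refl (φ : Formula) : imp φ φ ∈ T :=
  mp (ax (.a9 bot)) (curry (conj_imp_right (imp bot bot) φ))

theorem imp_swap (h : imp φ (imp ψ χ) ∈ T) : imp ψ (imp φ χ) ∈ T :=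
  curry (imp_trans (conj_comm_imp _ _) (uncurry h))

theorem imp_conj (φ ψ : Formula) : imp φ (imp ψ (conj φ ψ)) ∈ T :=
  curry (imp_refl _)

theorem imp_mp (φ ψ : Formula) : imp φ (imp (imp φ ψ) ψ) ∈ T :=
  imp_swap (imp_refl _)

theorem imp_mono (h₁ : imp ψ φ ∈ T) (h₂ : imp χ θ ∈ T) : imp (imp φ χ) (imp ψ θ) ∈ T :=
  imp_trans (mp h₁ (ax (.a1 _ _ _))) (mp h₂ (imp_swap (ax (.a1 _ _ _))))

theorem conj_mono_left (h : imp φ ψ ∈ T) (χ : Formula) : imp (conj φ χ) (conj ψ χ) ∈ T :=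
  uncurry (imp_trans h (imp_conj _ _))

theorem conj_mono (h₁ : imp φ ψ ∈ T) (h₂ : imp χ θ ∈ T) : imp (conj φ χ) (conj ψ θ) ∈ T :=
  imp_trans (conj_mono_left h₁ χ) (imp_trans (conj_comm_imp _ _)
    (imp_trans (conj_mono_left h₂ ψ) (conj_comm_imp _ _)))

theorem conj_assoc_imp (φ ψ χ : Formula) :
    imp (conj (conj φ ψ) χ) (conj φ (conj ψ χ)) ∈ T :=
  uncurry (uncurry (imp_trans (imp_conj _ _) (ax (.a7b _ _ _))))

theorem imp_conj_assoc (φ ψ χ : Formula) :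
    imp (conj φ (conj ψ χ)) (conj (conj φ ψ) χ) ∈ T :=
  uncurry (imp_trans (imp_conj _ _) (imp_trans (imp_mono (imp_refl _) (imp_conj _ _))
    (ax (.a7a _ _ _))))

theorem prelinear_cases (φ ψ : Formula) (h₁ : imp (imp φ ψ) χ ∈ T) (h₂ : imp (imp ψ φ) χ ∈ T) :
    χ ∈ T :=
  mp h₂ (mp h₁ (ax (.a8 _ _ _)))

theorem meet_imp_left (φ ψ : Formula) : imp (meet φ ψ) φ ∈ T :=
  ax (.a4 _ _)

theorem meet_comm_imp (φ ψ : Formula) : imp (meet φ ψ) (meet ψ φ) ∈ T :=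
  ax (.a5 _ _)

theorem meet_imp_right (φ ψ : Formula) : imp (meet φ ψ) ψ ∈ T :=
  imp_trans (meet_comm_imp _ _) (meet_imp_left _ _)

theorem imp_imp_meet (φ ψ : Formula) : imp φ (imp (imp φ ψ) (meet φ ψ)) ∈ T :=
  curry (imp_trans (ax (.a6 _ _)) (meet_comm_imp _ _))

theorem imp_meet (h₁ : imp χ φ ∈ T) (h₂ : imp χ ψ ∈ T) : imp χ (meet φ ψ) ∈ T :=
  prelinear_cases φ ψ
    (imp_swap (imp_trans h₁ (imp_imp_meet _ _)))
    (imp_swap (imp_trans h₂ (imp_trans (imp_imp_meet _ _)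
      (imp_mono (imp_refl _) (meet_comm_imp _ _)))))

theorem meet_mono (h₁ : imp φ ψ ∈ T) (h₂ : imp χ θ ∈ T) : imp (meet φ χ) (meet ψ θ) ∈ T :=
  imp_meet (imp_trans (meet_imp_left _ _) h₁) (imp_trans (meet_imp_right _ _) h₂)

theorem imp_disj_left (φ ψ : Formula) : imp φ (disj φ ψ) ∈ T :=
  imp_meet (imp_mp _ _) (imp_imp_self _ _)

theorem imp_disj_right (φ ψ : Formula) : imp ψ (disj φ ψ) ∈ T :=
  imp_meet (imp_imp_self _ _) (imp_mp _ _)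

theorem disj_imp (h₁ : imp φ χ ∈ T) (h₂ : imp ψ χ ∈ T) : imp (disj φ ψ) χ ∈ T :=
  prelinear_cases φ ψ
    (imp_swap (imp_trans (meet_imp_left _ _) (imp_mono (imp_refl _) h₂)))
    (imp_swap (imp_trans (meet_imp_right _ _) (imp_mono (imp_refl _) h₁)))

theorem disj_mono (h₁ : imp φ ψ ∈ T) (h₂ : imp χ θ ∈ T) : imp (disj φ χ) (disj ψ θ) ∈ T :=
  disj_imp (imp_trans h₁ (imp_disj_left _ _)) (imp_trans h₂ (imp_disj_right _ _))

theorem disj_comm (h : disj φ ψ ∈ T) : disj ψ φ ∈ T :=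
  mp h (disj_imp (imp_disj_right _ _) (imp_disj_left _ _))

theorem mem_of_disj_self (h : disj φ φ ∈ T) : φ ∈ T :=
  mp h (disj_imp (imp_refl _) (imp_refl _))

theorem disj_imp_disj_imp (φ ψ θ : Formula) :
    imp (disj φ θ) (imp (disj (imp φ ψ) θ) (disj ψ θ)) ∈ T :=
  have right (χ : Formula) : imp θ (imp χ (disj ψ θ)) ∈ T :=
    imp_trans (imp_disj_right _ _) (imp_imp_self _ _)
  disj_imp
    (imp_swap (disj_imp (imp_mono (imp_refl _) (imp_disj_left _ _)) (right φ)))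
    (right _)

/-- The coannihilator of `θ` modulo `T` is the theory of all `χ` with `χ ∨ θ ∈ T`. It is the
analogue for theories of the colon ideal of a ring. -/
def coannihilator (T : Theory) (θ : Formula) : Theory where
  carrier := {χ | disj χ θ ∈ T}
  ax' h := mp (ax h) (imp_disj_left _ _)
  mp' h₁ h₂ := mp h₂ (mp h₁ (disj_imp_disj_imp _ _ _))

theorem mem_coannihilator : χ ∈ T.coannihilator θ ↔ disj χ θ ∈ T := Iff.rfl

theorem le_coannihilator (T : Theory) (θ : Formula) : T ≤ T.coannihilator θ :=
  fun _ h => mem_coannihilator.2 (mp h (imp_disj_left _ _))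

/-- A theory is prime if it contains a member of each disjunction that it contains. The
inconsistent theory counts as prime, its Lindenbaum algebra being the one-element chain. -/
def IsPrime (T : Theory) : Prop := ∀ φ ψ : Formula, disj φ ψ ∈ T → φ ∈ T ∨ ψ ∈ T

theorem IsPrime.imp_total (hT : T.IsPrime) (φ ψ : Formula) : imp φ ψ ∈ T ∨ imp ψ φ ∈ T :=
  hT _ _ (prelinear_cases φ ψ (imp_disj_left _ _) (imp_disj_right _ _))

theorem IsPrime.of_maximal {D : Set Formula} (hD : DirectedOn (fun φ ψ => imp φ ψ ∈ T) D)
    (hT : Maximal (fun U : Theory => Disjoint (U : Set Formula) D) T) : T.IsPrime := by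
  intro φ ψ h
  have meets {χ θ : Formula} (hχ : χ ∉ T) (hχθ : disj χ θ ∈ T) : ∃ δ ∈ D, disj δ θ ∈ T := by
    by_contra! hδ
    exact hχ (hT.2 (Set.disjoint_right.2 hδ) (T.le_coannihilator θ) hχθ)
  by_contra! hn
  obtain ⟨δ, hδ, hδψ⟩ := meets hn.1 h
  obtain ⟨ε, hε, hεδ⟩ := meets hn.2 (disj_comm hδψ)
  obtain ⟨ζ, hζ, hδζ, hεζ⟩ := hD δ hδ ε hε
  exact Set.disjoint_left.1 hT.1 (mp hεδ (disj_imp hεζ hδζ)) hζ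

/-- The union of a nonempty directed set of theories. -/
def directedUnion (c : Set Theory) (hc : c.Nonempty) (hdir : DirectedOn (· ≤ ·) c) : Theory where
  carrier := ⋃ T ∈ c, T
  ax' h := Set.mem_biUnion hc.some_mem (ax h)
  mp' h₁ h₂ := by
    simp only [Set.mem_iUnion₂] at h₁ h₂ ⊢
    obtain ⟨T₁, hT₁, h₁⟩ := h₁
    obtain ⟨T₂, hT₂, h₂⟩ := h₂
    obtain ⟨T, hT, hle₁, hle₂⟩ := hdir T₁ hT₁ T₂ hT₂
    exact ⟨T, hT, mp (hle₁ h₁) (hle₂ h₂)⟩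

theorem exists_maximal_disjoint {D : Set Formula} (hTD : Disjoint (T : Set Formula) D) :
    ∃ M, T ≤ M ∧ Maximal (fun U : Theory => Disjoint (U : Set Formula) D) M :=
  zorn_le_nonempty₀ {U : Theory | Disjoint (U : Set Formula) D}
    (fun c hcD hc T hT => ⟨directedUnion c ⟨T, hT⟩ hc.directedOn,
      Set.disjoint_iUnion₂_left.2 fun _ hU => hcD hU,
      fun _ hU => Set.subset_biUnion_of_mem (u := fun U : Theory => (U : Set Formula)) hU⟩)
    T hTD

theorem exists_isPrime_disjoint {D : Set Formula} (hD : DirectedOn (fun φ ψ => imp φ ψ ∈ T) D)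
    (hTD : Disjoint (T : Set Formula) D) :
    ∃ M, T ≤ M ∧ M.IsPrime ∧ Disjoint (M : Set Formula) D := by
  obtain ⟨M, hTM, hM⟩ := exists_maximal_disjoint hTD
  exact ⟨M, hTM, .of_maximal (hD.mono' fun _ _ _ _ h => hTM h) hM, hM.1⟩

/-- Provable implication modulo a theory, as a preorder on formulas. -/
abbrev preorder (T : Theory) : Preorder Formula where
  le φ ψ := imp φ ψ ∈ T
  le_refl := imp_refl
  le_trans _ _ _ := imp_trans

/-- The Lindenbaum algebra of a theory: formulas modulo provable equivalence, ordered by provable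
implication. -/
def Lindenbaum (T : Theory) : Type :=
  letI := T.preorder
  Antisymmetrization Formula (· ≤ ·)

namespace Lindenbaum

/-- The class of a formula in the Lindenbaum algebra. -/
def of (T : Theory) (φ : Formula) : Lindenbaum T :=
  letI := T.preorder
  toAntisymmetrization (· ≤ ·) φ

theorem ind {p : Lindenbaum T → Prop} (h : ∀ φ, p (of T φ)) (x : Lindenbaum T) : p x :=
  Quotient.ind h x

theorem of_surjective (T : Theory) : Function.Surjective (of T) :=
  ind fun φ => ⟨φ, rfl⟩

instance : PartialOrder (Lindenbaum T) :=
  @instPartialOrderAntisymmetrization Formula T.preorder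

theorem of_le_of : of T φ ≤ of T ψ ↔ imp φ ψ ∈ T := Iff.rfl

instance : Lattice (Lindenbaum T) where
  inf := Quotient.map₂ meet fun _ _ h₁ _ _ h₂ => ⟨meet_mono h₁.1 h₂.1, meet_mono h₁.2 h₂.2⟩
  sup := Quotient.map₂ disj fun _ _ h₁ _ _ h₂ => ⟨disj_mono h₁.1 h₂.1, disj_mono h₁.2 h₂.2⟩
  inf_le_left := ind fun _ => ind fun _ => meet_imp_left _ _
  inf_le_right := ind fun _ => ind fun _ => meet_imp_right _ _
  le_inf := ind fun _ => ind fun _ => ind fun _ => imp_meet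
  le_sup_left := ind fun _ => ind fun _ => imp_disj_left _ _
  le_sup_right := ind fun _ => ind fun _ => imp_disj_right _ _
  sup_le := ind fun _ => ind fun _ => ind fun _ => disj_imp

instance : BoundedOrder (Lindenbaum T) where
  top := of T (imp bot bot)
  bot := of T bot
  le_top := ind fun φ => imp_of_mem (imp_refl bot) φ
  bot_le := ind fun φ => ax (.a9 φ)

instance : CommMonoid (Lindenbaum T) where
  mul := Quotient.map₂ conj fun _ _ h₁ _ _ h₂ => ⟨conj_mono h₁.1 h₂.1, conj_mono h₁.2 h₂.2⟩
  one := of T (imp bot bot)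
  mul_assoc := ind fun _ => ind fun _ => ind fun _ =>
    le_antisymm (conj_assoc_imp _ _ _) (imp_conj_assoc _ _ _)
  mul_comm := ind fun _ => ind fun _ => le_antisymm (conj_comm_imp _ _) (conj_comm_imp _ _)
  one_mul := ind fun _ => le_antisymm (conj_imp_right _ _) (mp (imp_refl bot) (imp_conj _ _))
  mul_one := ind fun _ =>
    le_antisymm (conj_imp_left _ _) (mp (imp_refl bot) (imp_swap (imp_conj _ _)))

theorem of_eq_one_iff : of T φ = 1 ↔ φ ∈ T :=
  ⟨fun h => mp (imp_refl bot) (of_le_of.1 h.ge),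
    fun h => le_antisymm (le_top (a := of T φ)) (imp_of_mem h (imp bot bot))⟩

instance : MTLAlgebra (Lindenbaum T) where
  res := Quotient.map₂ imp fun _ _ h₁ _ _ h₂ => ⟨imp_mono h₁.2 h₂.1, imp_mono h₁.1 h₂.2⟩
  one_eq_top := rfl
  mul_le_iff_le_res := ind fun _ => ind fun _ => ind fun _ => ⟨curry, uncurry⟩
  prelinearity := ind fun _ => ind fun _ => of_eq_one_iff.2
    (prelinear_cases _ _ (imp_disj_left _ _) (imp_disj_right _ _))

theorem eval_of (s : ℕ → Formula) (φ : Formula) :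
    φ.eval (fun n => of T (s n)) = of T (φ.subst s) := by
  induction φ with
  | var n => rfl
  | bot => rfl
  | conj φ ψ ih₁ ih₂ => exact congrArg₂ (· * ·) ih₁ ih₂
  | meet φ ψ ih₁ ih₂ => exact congrArg₂ (· ⊓ ·) ih₁ ih₂
  | imp φ ψ ih₁ ih₂ => exact congrArg₂ FLewAlgebra.res ih₁ ih₂

theorem valid_iff : Valid (Lindenbaum T) φ ↔ ∀ s : ℕ → Formula, φ.subst s ∈ T := by
  simp only [Valid, (of_surjective T).comp_left.forall, ← of_eq_one_iff, ← eval_of]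
  rfl

theorem isChain (hT : T.IsPrime) : IsChain (Lindenbaum T) :=
  ind fun φ => ind fun ψ => hT.imp_total φ ψ

end Lindenbaum

end Theory

theorem Derivable.mem_theory {S : Set Formula} {T : Theory}
    (hS : ∀ φ ∈ S, ∀ s : ℕ → Formula, φ.subst s ∈ T) {χ : Formula} (h : Derivable S χ) :
    χ ∈ T := by
  induction h with
  | mtl h => exact T.ax h
  | extra h s => exact hS _ h s
  | mp _ _ ih₁ ih₂ => exact T.mp ih₁ ih₂

namespace FLewAlgebra

variable {A : Type*} [FLewAlgebra A]

theorem le_one (x : A) : x ≤ 1 :=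
  one_eq_top (A := A) ▸ le_top

theorem res_eq_one_iff {x y : A} : res x y = 1 ↔ x ≤ y := by
  rw [← (le_one (res x y)).ge_iff_eq, ← mul_le_iff_le_res, one_mul]

theorem one_res (y : A) : res 1 y = y :=
  eq_of_forall_le_iff fun z => by rw [← mul_le_iff_le_res, mul_one]

instance : FLewAlgebra (ULift.{u} A) where
  res x y := ⟨res x.down y.down⟩
  one_eq_top := congrArg ULift.up one_eq_top
  mul_le_iff_le_res x y z := mul_le_iff_le_res x.down y.down z.down

end FLewAlgebra

section MTLAlgebra

variable {A : Type*} [MTLAlgebra A]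

theorem IsChain.eval_eq_one_of_eval_disj (hA : IsChain A) {φ ψ : Formula} {v : ℕ → A}
    (h : (disj φ ψ).eval v = 1) : φ.eval v = 1 ∨ ψ.eval v = 1 := by
  simp only [disj, Formula.eval] at h
  rcases hA (φ.eval v) (ψ.eval v) with hle | hle <;>
    rw [FLewAlgebra.res_eq_one_iff.2 hle, FLewAlgebra.one_res] at h
  · exact .inr ((FLewAlgebra.le_one _).antisymm (h ▸ inf_le_left))
  · exact .inl ((FLewAlgebra.le_one _).antisymm (h ▸ inf_le_right))

instance : MTLAlgebra (ULift.{u} A) where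
  prelinearity x y := congrArg ULift.up (MTLAlgebra.prelinearity x.down y.down)

theorem down_eval (v : ℕ → ULift.{u} A) (φ : Formula) :
    (φ.eval v).down = φ.eval fun n => (v n).down := by
  induction φ with
  | var n => rfl
  | bot => rfl
  | conj φ ψ ih₁ ih₂ => exact congrArg₂ (· * ·) ih₁ ih₂
  | meet φ ψ ih₁ ih₂ => exact congrArg₂ (· ⊓ ·) ih₁ ih₂
  | imp φ ψ ih₁ ih₂ => exact congrArg₂ FLewAlgebra.res ih₁ ih₂

theorem valid_ulift {φ : Formula} : Valid (ULift.{u} A) φ ↔ Valid A φ := by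
  simp only [Valid, ← ULift.down_inj, down_eval]
  exact (ULift.down_surjective.comp_left.forall (p := fun v => φ.eval v = 1)).symm

theorem IsChain.ulift (hA : IsChain A) : IsChain (ULift.{u} A) :=
  fun x y => hA x.down y.down

end MTLAlgebra

namespace Formula

theorem eval_congr {A : Type*} [MTLAlgebra A] {v w : ℕ → A} {φ : Formula}
    (h : ∀ n ∈ φ.vars, v n = w n) : φ.eval v = φ.eval w := by
  induction φ <;> simp_all [vars, eval]

theorem subst_congr {s t : ℕ → Formula} {φ : Formula} (h : ∀ n ∈ φ.vars, s n = t n) :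
    φ.subst s = φ.subst t := by
  induction φ <;> simp_all [vars, subst]

theorem exists_eval_eq_of_disjoint {A : Type*} [MTLAlgebra A] {φ ψ : Formula}
    (h : Disjoint φ.vars ψ.vars) (v w : ℕ → A) :
    ∃ u : ℕ → A, φ.eval u = φ.eval v ∧ ψ.eval u = ψ.eval w :=
  ⟨φ.vars.piecewise v w, eval_congr fun _ hn => Finset.piecewise_eq_of_mem _ _ _ hn,
    eval_congr fun _ hn => Finset.piecewise_eq_of_notMem _ _ _ (Finset.disjoint_right.1 h hn)⟩

theorem exists_subst_eq_of_disjoint {φ ψ : Formula} (h : Disjoint φ.vars ψ.vars)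
    (s t : ℕ → Formula) :
    ∃ u : ℕ → Formula, φ.subst u = φ.subst s ∧ ψ.subst u = ψ.subst t :=
  ⟨φ.vars.piecewise s t, subst_congr fun _ hn => Finset.piecewise_eq_of_mem _ _ _ hn,
    subst_congr fun _ hn => Finset.piecewise_eq_of_notMem _ _ _ (Finset.disjoint_right.1 h hn)⟩

theorem vars_disj (φ ψ : Formula) : (disj φ ψ).vars = φ.vars ∪ ψ.vars := by
  ext n
  simp only [disj, vars, Finset.mem_union]
  tauto

theorem vars_subst (s : ℕ → Formula) (φ : Formula) :
    (φ.subst s).vars = φ.vars.biUnion fun n => (s n).vars := by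
  induction φ <;> simp_all [vars, subst, Finset.union_biUnion]

/-- The `n`-th copy of a formula. The variables are renamed by `Nat.pair n`, so that copies with
different indices have no variables in common. -/
def copy (n : ℕ) (φ : Formula) : Formula := φ.subst fun k => var (Nat.pair n k)

theorem fst_unpair_of_mem_vars_copy {n k : ℕ} {φ : Formula} (h : k ∈ (φ.copy n).vars) :
    k.unpair.1 = n := by
  simp only [copy, vars_subst, vars, Finset.mem_biUnion, Finset.mem_singleton] at h
  obtain ⟨m, -, rfl⟩ := h
  rw [Nat.unpair_pair]

theorem disjoint_vars_copy {m n : ℕ} (h : m ≠ n) (φ ψ : Formula) :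
    Disjoint (φ.copy m).vars (ψ.copy n).vars :=
  Finset.disjoint_left.2 fun _ hm hn =>
    h ((fst_unpair_of_mem_vars_copy hm).symm.trans (fst_unpair_of_mem_vars_copy hn))

theorem subst_unpair_copy (n : ℕ) (φ : Formula) :
    (φ.copy n).subst (fun k => var k.unpair.2) = φ := by
  simp only [copy, subst_subst, subst, Nat.unpair_pair, subst_var]

/-- The disjunction of the copies of the first `n` members of a sequence of formulas, with the
variables of the members renamed apart. -/
def apartDisj (χ : ℕ → Formula) : ℕ → Formula
  | 0 => bot
  | n + 1 => disj (apartDisj χ n) ((χ n).copy n)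

theorem fst_unpair_lt_of_mem_vars_apartDisj {χ : ℕ → Formula} {n k : ℕ}
    (h : k ∈ (apartDisj χ n).vars) : k.unpair.1 < n := by
  induction n with
  | zero => simp only [apartDisj, vars, Finset.notMem_empty] at h
  | succ n ih =>
    rw [apartDisj, vars_disj, Finset.mem_union] at h
    rcases h with h | h
    · exact (ih h).trans n.lt_succ_self
    · exact (fst_unpair_of_mem_vars_copy h).trans_lt n.lt_succ_self

theorem disjoint_vars_apartDisj_copy (χ : ℕ → Formula) (n : ℕ) (φ : Formula) :
    Disjoint (apartDisj χ n).vars (φ.copy n).vars :=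
  Finset.disjoint_left.2 fun _ h h' =>
    (fst_unpair_lt_of_mem_vars_apartDisj h).ne (fst_unpair_of_mem_vars_copy h')

/-- An injective numbering of the formulas, witnessing that there are only countably many. -/
def code : Formula → ℕ
  | var n => Nat.pair 0 n
  | bot => Nat.pair 1 0
  | conj φ ψ => Nat.pair 2 (Nat.pair φ.code ψ.code)
  | meet φ ψ => Nat.pair 3 (Nat.pair φ.code ψ.code)
  | imp φ ψ => Nat.pair 4 (Nat.pair φ.code ψ.code)

theorem code_injective : Function.Injective code := by
  intro φ
  induction φ <;> intro ψ h <;> cases ψ <;> grind [code, Nat.pair_eq_pair]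

instance : Countable Formula := code_injective.countable

end Formula

theorem Theory.directedOn_range_apartDisj (T : Theory) (χ : ℕ → Formula) :
    DirectedOn (fun φ ψ => imp φ ψ ∈ T) (Set.range (apartDisj χ)) :=
  letI := T.preorder
  (monotone_nat_of_le_succ fun _ => imp_disj_left _ _).directed_le.directedOn_range

namespace AxiomaticExtension

variable {L : AxiomaticExtension} {φ ψ : Formula}

/-- The theorems of an axiomatic extension of MTL, as a theory. -/
def toTheory (L : AxiomaticExtension) : Theory where
  carrier := L.theorems
  ax' h := L.mem_of_derivable (.mtl h)
  mp' h₁ h₂ := L.mem_of_derivable (.mp (.of_mem h₁) (.of_mem h₂))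

theorem Proves.subst (h : L.Proves φ) (s : ℕ → Formula) : L.Proves (φ.subst s) :=
  L.mem_of_derivable (.extra h s)

theorem proves_copy_iff {n : ℕ} : L.Proves (φ.copy n) ↔ L.Proves φ :=
  ⟨fun h => subst_unpair_copy n φ ▸ h.subst _, fun h => h.subst _⟩

theorem Proves.disj_subst (hd : Disjoint φ.vars ψ.vars) (h : L.Proves (disj φ ψ))
    (s t : ℕ → Formula) : L.Proves (disj (φ.subst s) (ψ.subst t)) := by
  obtain ⟨u, hφ, hψ⟩ := exists_subst_eq_of_disjoint hd s t
  exact hφ ▸ hψ ▸ h.subst u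

theorem HalldenComplete.of_completeWrt {A : Type*} [MTLAlgebra A] (hA : IsChain A)
    (hL : CompleteWrt L A) : L.HalldenComplete := by
  intro φ ψ hd h
  simp only [hL _] at h ⊢
  by_contra! hn
  simp only [Valid, not_forall] at hn
  obtain ⟨⟨v, hv⟩, w, hw⟩ := hn
  obtain ⟨u, hφ, hψ⟩ := exists_eval_eq_of_disjoint hd v w
  exact (hA.eval_eq_one_of_eval_disj (h u)).elim (hφ ▸ hv) (hψ ▸ hw)

theorem HalldenComplete.meetIrreducible (hL : L.HalldenComplete) : MeetIrreducible L := by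
  rintro L₁ L₂ rfl
  by_contra! hne
  obtain ⟨φ, hφ₁, hφ₂⟩ := Set.not_subset.1 fun h : L₁ ≤ L₂ => hne.1 (inf_eq_left.2 h)
  obtain ⟨ψ, hψ₂, hψ₁⟩ := Set.not_subset.1 fun h : L₂ ≤ L₁ => hne.2 (inf_eq_right.2 h)
  have hdisj : (L₁ ⊓ L₂).Proves (disj (φ.copy 0) (ψ.copy 1)) :=
    ⟨L₁.toTheory.mp (proves_copy_iff.2 hφ₁) (Theory.imp_disj_left _ _),
      L₂.toTheory.mp (proves_copy_iff.2 hψ₂) (Theory.imp_disj_right _ _)⟩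
  rcases hL _ _ (disjoint_vars_copy zero_ne_one φ ψ) hdisj with h | h
  · exact hφ₂ (proves_copy_iff.1 h).2
  · exact hψ₁ (proves_copy_iff.1 h).1

/-- The extension of `L` by the additional axiom schema `φ`. -/
def adjoin (L : AxiomaticExtension) (φ : Formula) : AxiomaticExtension :=
  ofAxioms (insert φ L.theorems)

theorem proves_adjoin_self (L : AxiomaticExtension) (φ : Formula) : (L.adjoin φ).Proves φ :=
  .of_mem (Set.mem_insert _ _)

theorem le_adjoin (L : AxiomaticExtension) (φ : Formula) : L ≤ L.adjoin φ :=
  fun _ h => .of_mem (Set.mem_insert_of_mem _ h)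

theorem Proves.disj_of_adjoin {χ θ : Formula} (hχ : (L.adjoin φ).Proves χ)
    (h : ∀ s : ℕ → Formula, L.Proves (disj (φ.subst s) θ)) : L.Proves (disj χ θ) := by
  suffices χ ∈ L.toTheory.coannihilator θ from this
  refine Derivable.mem_theory ?_ hχ
  rintro α (rfl | hα) s
  · exact h s
  · exact L.toTheory.le_coannihilator θ (Proves.subst hα s)

theorem adjoin_inf_adjoin (hd : Disjoint φ.vars ψ.vars) (h : L.Proves (disj φ ψ)) :
    L.adjoin φ ⊓ L.adjoin ψ = L := by
  refine le_antisymm ?_ (le_inf (L.le_adjoin φ) (L.le_adjoin ψ))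
  rintro χ ⟨hφ, hψ⟩
  have disj_subst (t : ℕ → Formula) : L.Proves (disj χ (ψ.subst t)) :=
    Proves.disj_of_adjoin hφ fun s => h.disj_subst hd s t
  have disj_self : L.Proves (disj χ χ) :=
    Proves.disj_of_adjoin hψ fun t => L.toTheory.disj_comm (disj_subst t)
  exact L.toTheory.mem_of_disj_self disj_self

theorem HalldenComplete.of_meetIrreducible (hL : MeetIrreducible L) : L.HalldenComplete := by
  intro φ ψ hd h
  refine (hL _ _ (adjoin_inf_adjoin hd h).symm).imp (fun h => ?_) fun h => ?_
  · exact h ▸ L.proves_adjoin_self φ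
  · exact h ▸ L.proves_adjoin_self ψ

theorem HalldenComplete.not_proves_apartDisj (hL : L.HalldenComplete) (hbot : ¬ L.Proves bot)
    {χ : ℕ → Formula} (hχ : ∀ n, ¬ L.Proves (χ n)) (n : ℕ) : ¬ L.Proves (apartDisj χ n) := by
  induction n with
  | zero => exact hbot
  | succ n ih =>
    intro h
    exact (hL _ _ (disjoint_vars_apartDisj_copy χ n (χ n)) h).elim ih
      fun h => hχ n (proves_copy_iff.1 h)

theorem HalldenComplete.exists_isPrime (hL : L.HalldenComplete) :
    ∃ M : Theory, M.IsPrime ∧ ∀ φ, L.Proves φ ↔ ∀ s : ℕ → Formula, φ.subst s ∈ M := by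
  by_cases hbot : L.Proves bot
  · have hall (φ : Formula) : L.Proves φ := L.toTheory.mp hbot (L.toTheory.ax (.a9 φ))
    exact ⟨L.toTheory, fun φ _ _ => .inl (hall φ), fun φ => ⟨fun h => h.subst, fun _ => hall φ⟩⟩
  obtain ⟨χ, hχ⟩ := (Set.to_countable {φ | ¬ L.Proves φ}).exists_eq_range ⟨bot, hbot⟩
  have hχ_not (n : ℕ) : ¬ L.Proves (χ n) := hχ.ge (Set.mem_range_self n)
  obtain ⟨M, hLM, hprime, hM⟩ := Theory.exists_isPrime_disjoint
    (L.toTheory.directedOn_range_apartDisj χ)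
    (Set.disjoint_right.2 (Set.forall_mem_range.2 (hL.not_proves_apartDisj hbot hχ_not)))
  refine ⟨M, hprime, fun φ => ⟨fun h s => hLM (h.subst s), fun h => ?_⟩⟩
  by_contra hφ
  obtain ⟨n, rfl⟩ := hχ.le hφ
  have hcopy : (χ n).copy n ∈ M := h _
  exact Set.disjoint_right.1 hM ⟨n + 1, rfl⟩ (Theory.mp hcopy (Theory.imp_disj_right _ _))

theorem HalldenComplete.exists_isChain_completeWrt (hL : L.HalldenComplete) :
    ∃ (A : Type u) (_ : MTLAlgebra A), IsChain A ∧ CompleteWrt L A := by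
  obtain ⟨M, hprime, hM⟩ := hL.exists_isPrime
  refine ⟨ULift.{u} M.Lindenbaum, inferInstance, (Theory.Lindenbaum.isChain hprime).ulift,
    fun φ => ?_⟩
  rw [hM, valid_ulift, Theory.Lindenbaum.valid_iff]

end AxiomaticExtension

end MTL

theorem mainTheorem1 (L : MTL.AxiomaticExtension) :
    List.TFAE
      [L.HalldenComplete,
       ∃ (A : Type*) (_ : MTL.MTLAlgebra A), MTL.IsChain A ∧ MTL.CompleteWrt L A,
       MTL.MeetIrreducible L] := by
  tfae_have 1 → 2 := fun h => h.exists_isChain_completeWrt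
  tfae_have 2 → 1 := fun ⟨_, _, hA, hL⟩ => .of_completeWrt hA hL
  tfae_have 1 → 3 := fun h => h.meetIrreducible
  tfae_have 3 → 1 := .of_meetIrreducible
  tfae_finish
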